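/- Let $t_0<T$, $n\in\mathbb N$, $1\le p<\infty$. Write $|\cdot|$ for the Euclidean norm on $\mathbb R^n$, $d(y,K)=\inf_{x\in K}|x-y|$, $\operatorname{comp}\mathbb R^n$ for the set of nonempty compact subsets of $\mathbb R^n$, and $\rho_H$ for the Hausdorff metric on it. Let $L_p^n[t_0,T]$ be the space of $p$-integrable functions $[t_0,T]\to\mathbb R^n$ with norm $\left(\int_{t_0}^T|u(s)|^p\,ds\right)^{1/p}$, $C^n[t_0,T]$ the space of continuous functions $[t_0,T]\to\mathbb R^n$ with the supremum norm, and $\|f\|_p=\left(\int_{t_0}^T|f(s)|^p\,ds\right)^{1/p}$ for $f\in L_p[t_0,T]$. Let $S\subseteq[t_0,T]$ be a set of full Lebesgue measure (for $S=[t_0,T]$ all conditions below are imposed and all conclusions hold at every point; the case of general $S$ is the almost-everywhere version). Let $A:L_p^n[t_0,T]\to C^n[t_0,T]$ be a continuous linear operator, and let $F:[t_0,T]\times\mathbb R^n\to\operatorname{comp}\mathbb R^n$ be such that $t\mapsto F(t,x)$ is Lebesgue measurable for every $x\in\mathbb R^n$. Suppose that there is $M\in L_p[t_0,T]$ with $M(t)>0$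 for $t\in S$ such that $$\rho_H\big(F(t,x),F(t,x_1)\big)\le M(t)\,|x-x_1|\qquad (t\in S,\ x,x_1\in\mathbb R^n),$$ and that $\|A\|\,\|M\|_p<1$. Let $\rho\in L_p[t_0,T]$ and $\bar u\in L_p^n[t_0,T]$ satisfy $$d\big(\bar u(t),F(t,(A\bar u)(t))\big)\le\rho(t)\qquad(t\in S).$$ Then there is $u\in L_p^n[t_0,T]$ such that $u(t)\in F(t,(Au)(t))$ for all $t\in S$, $$|u(t)-\bar u(t)|\le\rho(t)+\frac{\|A\|\,\|\rho\|_p\,M(t)}{1-\|A\|\,\|M\|_p}\qquad(t\in S),$$ and $$|(Au)(t)-(A\bar u)(t)|\le\frac{\|A\|\,\|\rho\|_p}{1-\|A\|\,\|M\|_p}\qquad(t\in[t_0,T]).$$ -/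

import Mathlib

open MeasureTheory Set TopologicalSpace
open scoped ENNReal

/-- The time interval `[t₀, T]`. -/
abbrev TimeInterval (t₀ T : ℝ) : Type := ↥(Icc t₀ T)

/-- Lebesgue measure on `[t₀, T]`. -/
noncomputable abbrev lebesgue (t₀ T : ℝ) : Measure (TimeInterval t₀ T) :=
  (volume : Measure ℝ).comap Subtype.val

/-- `n`-dimensional Euclidean space with its Euclidean norm. -/
abbrev EucSpace (n : ℕ) : Type := EuclideanSpace ℝ (Fin n)

/-- The space `L_p^n[t₀, T]`, normed by `(∫ |u(s)|^p ds)^(1/p)`. -/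
abbrev LpSpace (t₀ T : ℝ) (n : ℕ) (p : ℝ≥0∞) : Type :=
  Lp (EucSpace n) p (lebesgue t₀ T)

/-- The space `C^n[t₀, T]` with the supremum norm. -/
abbrev CSpace (t₀ T : ℝ) (n : ℕ) : Type := C(TimeInterval t₀ T, EucSpace n)

/-- A compact-valued map on `[t₀, T]` is (Lebesgue) measurable: the set of all `t` at which the
value meets a given open set is Lebesgue measurable. -/
def IsMeasurableMultimap {t₀ T : ℝ} {n : ℕ}
    (G : TimeInterval t₀ T → NonemptyCompacts (EucSpace n)) : Prop :=
  ∀ U : Set (EucSpace n), IsOpen U →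
    NullMeasurableSet {t | ((G t : Set (EucSpace n)) ∩ U).Nonempty}
      (lebesgue t₀ T)

/-- The number `(∫_{t₀}^T |f(s)|^p ds)^(1/p)` of a scalar function `f`, for `1 ≤ p < ∞`. -/
noncomputable def pNorm {t₀ T : ℝ} (p : ℝ≥0∞) (f : TimeInterval t₀ T → ℝ) : ℝ :=
  (∫ s, |f s| ^ p.toReal ∂(lebesgue t₀ T)) ^ (1 / p.toReal)

/-! This is Filippov's successive approximation. Starting from `ubar`, let u_{k+1}(t) be a point of
F(t, (A u_k)(t)) nearest to u_k(t). Since u_{k+1}(t) already lies in F(t, (A u_k)(t)), the Lipschitz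
condition bounds the next increment by M(t) ‖A‖ ‖u_{k+1} - u_k‖_p. With q = ‖A‖ ‖M‖_p < 1 the
increments decay like q^k, both in L_p and, up to a factor depending on t, at every point of S. The
pointwise limit is therefore also the L_p limit; closedness of the values gives the inclusion, and
summing geometric series gives both estimates.

The iteration needs measurable nearest points (`exists_measurable_nearest_selection`). These come
from describing set-valued maps by the minima of continuous functions over their values, a
description that survives passing to minimizers. -/

section Selection

/-! ### Measurability of minima over set-valued maps -/

variable {Ω E Y : Type*} [MeasurableSpace Ω]

/-- The points of `K` at which `g` attains its infimum over `K`. -/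
def argminOn (g : E → ℝ) (K : Set E) : Set E := {z ∈ K | g z = sInf (g '' K)}

variable [TopologicalSpace E]

theorem IsCompact.exists_mem_argminOn {K : Set E} (hK : IsCompact K) (hne : K.Nonempty)
    {g : E → ℝ} (hg : Continuous g) : (argminOn g K).Nonempty := by
  obtain ⟨z, hz, h, -⟩ := hK.exists_sInf_image_eq_and_le hne hg.continuousOn
  exact ⟨z, hz, h.symm⟩

theorem IsCompact.sInf_image_le {K : Set E} (hK : IsCompact K) {g : E → ℝ} (hg : Continuous g)
    {z : E} (hz : z ∈ K) : sInf (g '' K) ≤ g z :=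
  csInf_le (hK.image hg).bddBelow (mem_image_of_mem g hz)

theorem IsCompact.argminOn {K : Set E} (hK : IsCompact K) {g : E → ℝ} (hg : Continuous g) :
    IsCompact (argminOn g K) :=
  hK.inter_right (isClosed_eq hg continuous_const)

theorem IsCompact.lt_sInf_image_iff {K : Set E} (hK : IsCompact K) (hne : K.Nonempty)
    {g : E → ℝ} (hg : Continuous g) {c : ℝ} : c < sInf (g '' K) ↔ ∀ z ∈ K, c < g z := by
  refine ⟨fun h z hz => h.trans_le (hK.sInf_image_le hg hz), fun h => ?_⟩
  obtain ⟨z, hz, hz'⟩ := hK.exists_mem_argminOn hne hg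
  exact hz' ▸ h z hz

theorem IsCompact.sInf_image_lt_iff {K : Set E} (hK : IsCompact K) (hne : K.Nonempty)
    {g : E → ℝ} (hg : Continuous g) {c : ℝ} : sInf (g '' K) < c ↔ ∃ z ∈ K, g z < c := by
  refine ⟨fun h => ?_, fun ⟨z, hz, h⟩ => (hK.sInf_image_le hg hz).trans_lt h⟩
  obtain ⟨z, hz, hz'⟩ := hK.exists_mem_argminOn hne hg
  exact ⟨z, hz, hz' ▸ h⟩

/-- The minimum of `f` over the minimizers of `g` is the supremum of the minima of the functions
obtained from `f` by penalizing non-minimizers. -/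
theorem IsCompact.lt_sInf_image_argminOn_iff {K : Set E} (hK : IsCompact K) (hne : K.Nonempty)
    {f g : E → ℝ} (hf : Continuous f) (hg : Continuous g) {c : ℝ} :
    c < sInf (f '' _root_.argminOn g K) ↔
      ∃ k : ℕ, c < sInf ((fun z => f z + k * (g z - sInf (g '' K))) '' K) := by
  have hcont : ∀ k : ℕ, Continuous fun z => f z + k * (g z - sInf (g '' K)) := fun k => by
    fun_prop
  have hnn : ∀ z ∈ K, 0 ≤ g z - sInf (g '' K) := fun z hz =>
    sub_nonneg.2 (hK.sInf_image_le hg hz)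
  rw [(hK.argminOn hg).lt_sInf_image_iff (hK.exists_mem_argminOn hne hg) hf]
  simp only [hK.lt_sInf_image_iff hne (hcont _)]
  constructor
  · intro h
    -- Truncating the penalty at 0 makes these open sets increase with `k` off `K` too, so by
    -- compactness a single `k` suffices.
    have hcover : K ⊆ ⋃ k : ℕ, {z | c < f z + k * max (g z - sInf (g '' K)) 0} := by
      intro z hz
      rw [mem_iUnion]
      rcases (hnn z hz).eq_or_lt with h0 | h0
      · exact ⟨0, by simpa using h z ⟨hz, by linarith⟩⟩
      · obtain ⟨k, hk⟩ := exists_nat_gt ((c - f z) / (g z - sInf (g '' K)))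
        refine ⟨k, ?_⟩
        rw [div_lt_iff₀ h0] at hk
        simp only [mem_ofPred_eq, max_eq_left h0.le]
        linarith
    obtain ⟨k, hk⟩ := hK.elim_directed_cover _
      (fun k => isOpen_lt continuous_const (by fun_prop)) hcover
      (directed_of_isDirected_le fun i j hij z (hz : c < _) => hz.trans_le (by gcongr))
    refine ⟨k, fun z hz => ?_⟩
    have := hk hz
    rwa [mem_ofPred_eq, max_eq_left (hnn z hz)] at this
  · rintro ⟨k, hk⟩ z ⟨hz, hgz⟩
    simpa [hgz] using hk z hz

/-- All minima of continuous functions over the values of the set-valued map `H` are measurable. -/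
def MeasurableMins (H : Ω → Set E) : Prop :=
  ∀ f : E → ℝ, Continuous f → Measurable fun t => sInf (f '' H t)

variable [TopologicalSpace Y] [MetrizableSpace Y] [SecondCountableTopology Y]
  [MeasurableSpace Y] [OpensMeasurableSpace Y]

/-- The minimum is continuous in the parameter and measurable in `t`: a Carathéodory function, hence
jointly measurable. -/
theorem MeasurableMins.parametrized {H : Ω → Set E} (hH : MeasurableMins H)
    (hc : ∀ t, IsCompact (H t)) {f : Y → E → ℝ} (hf : Continuous ↿f)
    {v : Ω → Y} (hv : Measurable v) : Measurable fun t => sInf (f (v t) '' H t) :=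
  (measurable_uncurry_of_continuous_of_measurable (u := fun y t => sInf (f y '' H t))
    (fun t => (hc t).continuous_sInf hf)
    fun y => hH (f y) (hf.comp (Continuous.prodMk_right y))).comp (hv.prodMk measurable_id)

/-- Penalization turns each superlevel set into a countable union; the minimum of `g (v t)` enters
as an extra real parameter. -/
theorem MeasurableMins.argminOn [BorelSpace Y] {H : Ω → Set E} (hH : MeasurableMins H)
    (hc : ∀ t, IsCompact (H t)) (hne : ∀ t, (H t).Nonempty) {g : Y → E → ℝ} (hg : Continuous ↿g)
    {v : Ω → Y} (hv : Measurable v) : MeasurableMins fun t => argminOn (g (v t)) (H t) := by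
  intro f hf
  have hgt : ∀ t, Continuous (g (v t)) := fun t => hg.comp (Continuous.prodMk_right (v t))
  refine measurable_of_Ioi fun c => ?_
  have hset : (fun t => sInf (f '' _root_.argminOn (g (v t)) (H t))) ⁻¹' Ioi c =
      ⋃ k : ℕ, (fun t => sInf ((fun z => f z + k * (g (v t) z - sInf (g (v t) '' H t))) '' H t)) ⁻¹'
        Ioi c := by
    ext t
    simp only [mem_preimage, mem_Ioi, mem_iUnion]
    exact (hc t).lt_sInf_image_argminOn_iff (hne t) hf (hgt t)
  rw [hset]
  refine MeasurableSet.iUnion fun k => ?_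
  refine hH.parametrized (Y := Y × ℝ) hc (f := fun q z => f z + k * (g q.1 z - q.2))
    (v := fun t => (v t, sInf (g (v t) '' H t))) ?_
    (hv.prodMk (hH.parametrized hc hg hv)) measurableSet_Ioi
  have h1 : Continuous fun q : (Y × ℝ) × E => g q.1.1 q.2 :=
    hg.comp ((continuous_fst.comp continuous_fst).prodMk continuous_snd)
  change Continuous fun q : (Y × ℝ) × E => f q.2 + k * (g q.1.1 q.2 - q.1.2)
  fun_prop

end Selection

/-! ### Measurable selections in Euclidean space -/

section Euclidean

variable {Ω : Type*} [MeasurableSpace Ω] {n : ℕ}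

/-- Minimizing the coordinates one after another leaves a single point, whose coordinates are
measurable minima. -/
theorem MeasurableMins.exists_measurable_selection {H : Ω → Set (EucSpace n)}
    (hH : MeasurableMins H) (hc : ∀ t, IsCompact (H t)) (hne : ∀ t, (H t).Nonempty) :
    ∃ s : Ω → EucSpace n, Measurable s ∧ ∀ t, s t ∈ H t := by
  have key : ∀ l : List (Fin n), ∃ H' : Ω → Set (EucSpace n), MeasurableMins H' ∧
      (∀ t, IsCompact (H' t)) ∧ (∀ t, (H' t).Nonempty) ∧ (∀ t, H' t ⊆ H t) ∧
      ∀ i ∈ l, ∀ t, ∀ z ∈ H' t, z i = sInf ((fun w : EucSpace n => w i) '' H' t) := by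
    intro l
    induction l with
    | nil => exact ⟨H, hH, hc, hne, fun t => Subset.rfl, by simp⟩
    | cons j l ih =>
      obtain ⟨H', h1, h2, h3, h4, h5⟩ := ih
      have hj : Continuous fun w : EucSpace n => w j := by fun_prop
      have hne' := fun t => (h2 t).exists_mem_argminOn (h3 t) hj
      refine ⟨fun t => _root_.argminOn (fun w : EucSpace n => w j) (H' t),
        h1.argminOn (Y := ℝ) h2 h3 (g := fun _ w => w j) (v := fun _ => 0)
          (hj.comp continuous_snd) measurable_const,
        fun t => (h2 t).argminOn hj, hne', fun t z hz => h4 t hz.1, ?_⟩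
      intro i hi t z hz
      have hconst : ∀ w ∈ _root_.argminOn (fun w : EucSpace n => w j) (H' t), w i = z i := by
        intro w hw
        rcases List.mem_cons.1 hi with rfl | hi
        · exact hw.2.trans hz.2.symm
        · rw [h5 i hi t w hw.1, h5 i hi t z hz.1]
      rw [image_congr hconst, (hne' t).image_const, csInf_singleton]
  obtain ⟨H', h1, h2, h3, h4, h5⟩ := key (List.finRange n)
  choose s hs using h3
  refine ⟨s, ?_, fun t => h4 t (hs t)⟩
  have hs' : s = fun t => WithLp.toLp 2 fun i => sInf ((fun w : EucSpace n => w i) '' H' t) := by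
    ext t i
    exact h5 i (List.mem_finRange i) t _ (hs t)
  rw [hs']
  exact (WithLp.measurable_toLp 2 _).comp
    (measurable_pi_lambda _ fun i => h1 _ (by fun_prop))

/-- Open rays pull back to the two basic kinds of Vietoris open sets. -/
theorem continuous_sInf_image_nonemptyCompacts {E : Type*} [MetricSpace E] {f : E → ℝ}
    (hf : Continuous f) : Continuous fun K : NonemptyCompacts E => sInf (f '' (K : Set E)) := by
  refine OrderTopology.continuous_iff.2 fun c => ⟨?_, ?_⟩
  · have : (fun K : NonemptyCompacts E => sInf (f '' (K : Set E))) ⁻¹' Ioi c =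
        {K : NonemptyCompacts E | (K : Set E) ⊆ f ⁻¹' Ioi c} := by
      ext K
      exact K.isCompact.lt_sInf_image_iff K.nonempty hf
    rw [this]
    exact NonemptyCompacts.isOpen_subsets_of_isOpen (isOpen_Ioi.preimage hf)
  · have : (fun K : NonemptyCompacts E => sInf (f '' (K : Set E))) ⁻¹' Iio c =
        {K : NonemptyCompacts E | ((K : Set E) ∩ f ⁻¹' Iio c).Nonempty} := by
      ext K
      exact K.isCompact.sInf_image_lt_iff K.nonempty hf
    rw [this]
    exact NonemptyCompacts.isOpen_inter_nonempty_of_isOpen (isOpen_Iio.preimage hf)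

/-- A measurable nearest-point selection along a set-valued Carathéodory map. -/
theorem exists_measurable_nearest_selection {F : Ω → EucSpace n → NonemptyCompacts (EucSpace n)}
    (hmeas : ∀ x, ∀ U : Set (EucSpace n), IsOpen U →
      MeasurableSet {t | ((F t x : Set (EucSpace n)) ∩ U).Nonempty})
    (hcont : ∀ t, Continuous (F t)) {x v : Ω → EucSpace n} (hx : Measurable x)
    (hv : Measurable v) :
    ∃ s : Ω → EucSpace n, Measurable s ∧
      ∀ t, s t ∈ F t (x t) ∧ ‖s t - v t‖ = Metric.infDist (v t) (F t (x t) : Set (EucSpace n)) := by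
  have hmins : MeasurableMins fun t => (F t (x t) : Set (EucSpace n)) := by
    intro f hf
    refine (measurable_uncurry_of_continuous_of_measurable
      (u := fun y t => sInf (f '' (F t y : Set (EucSpace n))))
      (fun t => (continuous_sInf_image_nonemptyCompacts hf).comp (hcont t))
      fun y => measurable_of_Iio fun c => ?_).comp (hx.prodMk measurable_id)
    convert hmeas y (f ⁻¹' Iio c) (isOpen_Iio.preimage hf) using 1
    ext t
    exact (F t y).isCompact.sInf_image_lt_iff (F t y).nonempty hf
  have hc := fun t => (F t (x t)).isCompact
  have hne := fun t => (F t (x t)).nonempty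
  have hg : Continuous ↿(fun y z : EucSpace n => ‖z - y‖) := by
    change Continuous fun q : EucSpace n × EucSpace n => ‖q.2 - q.1‖
    fun_prop
  have hgt : ∀ t, Continuous fun z : EucSpace n => ‖z - v t‖ := fun t => by fun_prop
  obtain ⟨s, hs, hs'⟩ := (hmins.argminOn hc hne hg hv).exists_measurable_selection
    (fun t => (hc t).argminOn (hgt t)) (fun t => (hc t).exists_mem_argminOn (hne t) (hgt t))
  refine ⟨s, hs, fun t => ⟨(hs' t).1, ?_⟩⟩
  obtain ⟨w, hw, hw'⟩ := (hc t).exists_infDist_eq_dist (hne t) (v t)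
  apply le_antisymm
  · rw [hw', dist_comm, dist_eq_norm]
    exact (hs' t).2.trans_le <| (hc t).sInf_image_le (hgt t) hw
  · rw [← dist_eq_norm, dist_comm]
    exact Metric.infDist_le_dist_of_mem (hs' t).1

end Euclidean

/-! ### Filippov iteration and L_p estimates -/

section Filippov

open Filter Topology

theorem hausdorffEDist_nonemptyCompacts_ne_top {E : Type*} [MetricSpace E]
    (K L : NonemptyCompacts E) : Metric.hausdorffEDist (K : Set E) (L : Set E) ≠ ⊤ :=
  Metric.hausdorffEDist_ne_top_of_nonempty_of_bounded K.nonempty L.nonempty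
    K.isCompact.isBounded L.isCompact.isBounded

/-- Almost everywhere version of `exists_measurable_nearest_selection`, with continuity assumed
only on a set of full measure. -/
theorem exists_aemeasurable_nearest_selection {Ω : Type*} [MeasurableSpace Ω] {n : ℕ}
    {μ : Measure Ω} {S : Set Ω} (hS : ∀ᵐ t ∂μ, t ∈ S)
    {F : Ω → EucSpace n → NonemptyCompacts (EucSpace n)}
    (hmeas : ∀ x, ∀ U : Set (EucSpace n), IsOpen U →
      NullMeasurableSet {t | ((F t x : Set (EucSpace n)) ∩ U).Nonempty} μ)
    (hcont : ∀ t ∈ S, Continuous (F t)) {x v : Ω → EucSpace n} (hx : AEMeasurable x μ)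
    (hv : AEMeasurable v μ) :
    ∃ s : Ω → EucSpace n, AEMeasurable s μ ∧
      ∀ t ∈ S, s t ∈ F t (x t) ∧
        ‖s t - v t‖ = Metric.infDist (v t) (F t (x t) : Set (EucSpace n)) := by
  classical
  -- Null measurable sets become the measurable ones, so changing `F` to the constant `{0}` off `S`
  -- is harmless and gives continuity everywhere.
  obtain ⟨s, hs, h⟩ := exists_measurable_nearest_selection (Ω := NullMeasurableSpace Ω μ)
    (F := fun t y => if t ∈ S then F t y else {0}) (x := x) (v := v) (fun y U hU => by
      refine (hmeas y U hU).congr ?_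
      refine eventuallyEq_set.2 ?_
      filter_upwards [hS] with t ht
      exact iff_of_eq (congrArg (fun K : NonemptyCompacts (EucSpace n) =>
        ((K : Set (EucSpace n)) ∩ U).Nonempty) (if_pos ht).symm)) (fun t => by
      by_cases ht : t ∈ S
      · simpa only [if_pos ht] using hcont t ht
      · simpa only [if_neg ht] using continuous_const)
    hx.nullMeasurable hv.nullMeasurable
  refine ⟨s, NullMeasurable.aemeasurable (μ := μ) hs, fun t ht => ?_⟩
  have hF : (if t ∈ S then F t (x t) else {0}) = F t (x t) := if_pos ht
  exact hF ▸ h t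

variable {t₀ T : ℝ} {n : ℕ} {p : ℝ≥0∞}

theorem pNorm_eq_norm_toLp [Fact (1 ≤ p)] (hp : p ≠ ∞) {f : TimeInterval t₀ T → ℝ}
    (hf : MemLp f p (lebesgue t₀ T)) : pNorm p f = ‖hf.toLp f‖ := by
  have hp0 : p ≠ 0 := (zero_lt_one.trans_le (Fact.out : 1 ≤ p)).ne'
  rw [Lp.norm_toLp, hf.eLpNorm_eq_integral_rpow_norm hp0 hp, ENNReal.toReal_ofReal (by positivity),
    pNorm, one_div]
  rfl

theorem norm_toLp_le_norm_toLp {Ω E : Type*} [MeasurableSpace Ω] {μ : Measure Ω}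
    [NormedAddCommGroup E] {f : Ω → E} {g : Ω → ℝ} (hf : MemLp f p μ) (hg : MemLp g p μ)
    (h : ∀ᵐ t ∂μ, ‖f t‖ ≤ g t) : ‖hf.toLp f‖ ≤ ‖hg.toLp g‖ := by
  refine Lp.norm_le_norm_of_ae_le ?_
  filter_upwards [hf.coeFn_toLp, hg.coeFn_toLp, h] with t h1 h2 h3
  rw [h1, h2]
  exact h3.trans (le_abs_self _)

theorem norm_toLp_sub_le_of_le_add_mul [Fact (1 ≤ p)] {Ω E : Type*} [MeasurableSpace Ω]
    {μ : Measure Ω} [NormedAddCommGroup E] {f f' : Ω → E} {g M : Ω → ℝ} {c : ℝ} (hc : 0 ≤ c)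
    (hf : MemLp f p μ) (hf' : MemLp f' p μ) (hg : MemLp g p μ) (hM : MemLp M p μ)
    (h : ∀ᵐ t ∂μ, ‖f t - f' t‖ ≤ g t + c * M t) :
    ‖hf.toLp f - hf'.toLp f'‖ ≤ ‖hg.toLp g‖ + c * ‖hM.toLp M‖ := by
  rw [← MemLp.toLp_sub]
  refine (norm_toLp_le_norm_toLp (hf.sub hf') (hg.add (hM.const_smul c)) h).trans ?_
  rw [MemLp.toLp_add hg (hM.const_smul c), MemLp.toLp_const_smul]
  refine (norm_add_le _ _).trans (le_of_eq ?_)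
  rw [norm_smul, Real.norm_of_nonneg hc]

theorem norm_toLp_sub_le_of_le_mul [Fact (1 ≤ p)] {Ω E : Type*} [MeasurableSpace Ω]
    {μ : Measure Ω} [NormedAddCommGroup E] {f f' : Ω → E} {M : Ω → ℝ} {c : ℝ} (hc : 0 ≤ c)
    (hf : MemLp f p μ) (hf' : MemLp f' p μ) (hM : MemLp M p μ)
    (h : ∀ᵐ t ∂μ, ‖f t - f' t‖ ≤ c * M t) :
    ‖hf.toLp f - hf'.toLp f'‖ ≤ c * ‖hM.toLp M‖ := by
  rw [← MemLp.toLp_sub]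
  refine (norm_toLp_le_norm_toLp (hf.sub hf') (hM.const_smul c) h).trans (le_of_eq ?_)
  rw [MemLp.toLp_const_smul, norm_smul, Real.norm_of_nonneg hc]

theorem ContinuousLinearMap.norm_apply_sub_apply_le [Fact (1 ≤ p)]
    (A : LpSpace t₀ T n p →L[ℝ] CSpace t₀ T n) (f g : LpSpace t₀ T n p) (t : TimeInterval t₀ T) :
    ‖A f t - A g t‖ ≤ ‖A‖ * ‖f - g‖ := by
  rw [← ContinuousMap.sub_apply, ← map_sub]
  exact (ContinuousMap.norm_coe_le_norm _ t).trans (A.le_opNorm _)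

end Filippov

theorem mainTheorem2 {t₀ T : ℝ} (hT : t₀ < T) (n : ℕ)
    (p : ℝ≥0∞) [Fact (1 ≤ p)] (hp : p ≠ ∞)
    -- a set of full measure on which the pointwise conditions are imposed
    (S : Set (TimeInterval t₀ T)) (hS : ∀ᵐ t ∂(lebesgue t₀ T), t ∈ S)
    (A : LpSpace t₀ T n p →L[ℝ] CSpace t₀ T n)
    (F : TimeInterval t₀ T → EucSpace n → NonemptyCompacts (EucSpace n))
    (hF : ∀ x, IsMeasurableMultimap (fun t => F t x))
    (M : TimeInterval t₀ T → ℝ) (hM : MemLp M p (lebesgue t₀ T)) (hMpos : ∀ t ∈ S, 0 < M t)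
    (hLip : ∀ t ∈ S, ∀ x x₁ : EucSpace n,
      Metric.hausdorffDist (F t x : Set (EucSpace n)) (F t x₁) ≤ M t * ‖x - x₁‖)
    (hAM : ‖A‖ * pNorm p M < 1)
    (ρ : TimeInterval t₀ T → ℝ) (hρ : MemLp ρ p (lebesgue t₀ T))
    (ubar : TimeInterval t₀ T → EucSpace n) (hubar : MemLp ubar p (lebesgue t₀ T))
    (hdist : ∀ t ∈ S,
      Metric.infDist (ubar t) (F t (A (hubar.toLp ubar) t) : Set (EucSpace n)) ≤ ρ t) :
    ∃ (u : TimeInterval t₀ T → EucSpace n) (hu : MemLp u p (lebesgue t₀ T)),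
      (∀ t ∈ S, u t ∈ F t (A (hu.toLp u) t)) ∧
      (∀ t ∈ S, ‖u t - ubar t‖ ≤ ρ t + ‖A‖ * pNorm p ρ * M t / (1 - ‖A‖ * pNorm p M)) ∧
      (∀ t, ‖A (hu.toLp u) t - A (hubar.toLp ubar) t‖ ≤
        ‖A‖ * pNorm p ρ / (1 - ‖A‖ * pNorm p M)) := by
  open Filter Topology in
  rw [pNorm_eq_norm_toLp hp hM] at hAM ⊢
  rw [pNorm_eq_norm_toLp hp hρ]
  set q := ‖A‖ * ‖hM.toLp M‖ with hq
  set N := ‖hρ.toLp ρ‖ with hN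
  have hN0 : 0 ≤ N := norm_nonneg _
  have hq0 : 0 ≤ q := by positivity
  have hq1 : 0 < 1 - q := by linarith
  have hinf : ∀ t ∈ S, ∀ x x₁ y, Metric.infDist y (F t x₁ : Set (EucSpace n)) ≤
      Metric.infDist y (F t x : Set (EucSpace n)) + M t * ‖x - x₁‖ := fun t ht x x₁ y =>
    (Metric.infDist_le_infDist_add_hausdorffDist
      (hausdorffEDist_nonemptyCompacts_ne_top (F t x) (F t x₁))).trans
      (by gcongr; exact hLip t ht x x₁)
  have hcont : ∀ t ∈ S, Continuous (F t) := fun t ht =>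
    (LipschitzWith.of_dist_le_mul (K := ⟨M t, (hMpos t ht).le⟩) fun x y => by
      rw [Metric.NonemptyCompacts.dist_eq, dist_eq_norm]
      exact hLip t ht x y).continuous
  have step : ∀ w : {w : TimeInterval t₀ T → EucSpace n // MemLp w p (lebesgue t₀ T)},
      ∃ w' : {w : TimeInterval t₀ T → EucSpace n // MemLp w p (lebesgue t₀ T)},
        ∀ t ∈ S, w'.1 t ∈ F t (A (w.2.toLp w.1) t) ∧ ‖w'.1 t - w.1 t‖ =
          Metric.infDist (w.1 t) (F t (A (w.2.toLp w.1) t) : Set (EucSpace n)) := by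
    rintro ⟨w, hw⟩
    obtain ⟨s, hs, hs'⟩ := exists_aemeasurable_nearest_selection hS hF hcont
      (A (hw.toLp w)).continuous.measurable.aemeasurable hw.1.aemeasurable
    have hsub : MemLp (s - w) p (lebesgue t₀ T) := by
      -- The distance from `w t` to its value set is estimated by way of `ubar t` and its value set.
      refine MemLp.mono' (g := fun t => ‖w t - ubar t‖ + ρ t +
        (‖A‖ * ‖hubar.toLp ubar - hw.toLp w‖) * M t)
        (((hw.sub hubar).norm.add hρ).add (hM.const_mul _))
        (hs.aestronglyMeasurable.sub hw.1) ?_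
      filter_upwards [hS] with t ht
      rw [Pi.sub_apply, (hs' t ht).2]
      have h1 := hinf t ht (A (hubar.toLp ubar) t) (A (hw.toLp w) t) (w t)
      have h2 := Metric.infDist_le_infDist_add_dist
        (s := (F t (A (hubar.toLp ubar) t) : Set (EucSpace n))) (x := w t) (y := ubar t)
      rw [dist_eq_norm] at h2
      have h3 := mul_le_mul_of_nonneg_left
        (A.norm_apply_sub_apply_le (hubar.toLp ubar) (hw.toLp w) t) (hMpos t ht).le
      linarith [hdist t ht]
    exact ⟨⟨s, by simpa using hsub.add hw⟩, hs'⟩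
  choose next hnext using step
  let U : ℕ → {w : TimeInterval t₀ T → EucSpace n // MemLp w p (lebesgue t₀ T)} :=
    fun k => next^[k] ⟨ubar, hubar⟩
  have hU : ∀ k, U (k + 1) = next (U k) := fun k => Function.iterate_succ_apply' _ _ _
  let V : ℕ → LpSpace t₀ T n p := fun k => (U k).2.toLp (U k).1
  have hmem : ∀ k, ∀ t ∈ S, (U (k + 1)).1 t ∈ F t (A (V k) t) := fun k t ht => by
    rw [hU]; exact (hnext (U k) t ht).1
  have hfirst : ∀ t ∈ S, ‖(U 1).1 t - ubar t‖ ≤ ρ t := fun t ht =>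
    (hnext (U 0) t ht).2.trans_le (hdist t ht)
  have hlater : ∀ k, ∀ t ∈ S, ‖(U (k + 2)).1 t - (U (k + 1)).1 t‖ ≤
      (‖A‖ * ‖V (k + 1) - V k‖) * M t := fun k t ht => by
    rw [hU (k + 1), (hnext (U (k + 1)) t ht).2]
    have h1 := hinf t ht (A (V k) t) (A (V (k + 1)) t) ((U (k + 1)).1 t)
    rw [Metric.infDist_zero_of_mem (hmem k t ht), zero_add, norm_sub_rev] at h1
    exact h1.trans (by
      rw [mul_comm]
      exact mul_le_mul_of_nonneg_right (A.norm_apply_sub_apply_le _ _ t) (hMpos t ht).le)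
  have hV : ∀ k, ‖V (k + 1) - V k‖ ≤ N * q ^ k := by
    intro k
    induction k with
    | zero =>
      rw [pow_zero, mul_one, ← MemLp.toLp_sub]
      refine norm_toLp_le_norm_toLp _ hρ ?_
      filter_upwards [hS] with t ht using hfirst t ht
    | succ k ih =>
      refine (norm_toLp_sub_le_of_le_mul (c := ‖A‖ * ‖V (k + 1) - V k‖) (by positivity)
        (U (k + 2)).2 (U (k + 1)).2 hM ?_).trans ?_
      · filter_upwards [hS] with t ht using hlater k t ht
      · calc ‖A‖ * ‖V (k + 1) - V k‖ * ‖hM.toLp M‖ = q * ‖V (k + 1) - V k‖ := by rw [hq]; ring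
          _ ≤ q * (N * q ^ k) := by gcongr
          _ = N * q ^ (k + 1) := by ring
  have hgeo : ∀ t ∈ S, ∀ k, dist ((U (k + 1)).1 t) ((U (k + 1 + 1)).1 t) ≤
      (‖A‖ * N * M t) * q ^ k := fun t ht k => by
    rw [dist_comm, dist_eq_norm]
    refine (hlater k t ht).trans ?_
    calc ‖A‖ * ‖V (k + 1) - V k‖ * M t ≤ ‖A‖ * (N * q ^ k) * M t := by
          have := (hMpos t ht).le
          gcongr
          exact hV k
      _ = _ := by ring
  have hlim : ∀ t, ∃ z, t ∈ S → Tendsto (fun k => (U (k + 1)).1 t) atTop (𝓝 z) := fun t => by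
    by_cases ht : t ∈ S
    · obtain ⟨z, hz⟩ := cauchySeq_tendsto_of_complete
        (cauchySeq_of_le_geometric q _ hAM (hgeo t ht))
      exact ⟨z, fun _ => hz⟩
    · exact ⟨0, fun h => absurd h ht⟩
  choose u hulim using hlim
  have hubound : ∀ t ∈ S, ‖u t - ubar t‖ ≤ ρ t + ‖A‖ * N / (1 - q) * M t := fun t ht => by
    have h1 := dist_le_of_le_geometric_of_tendsto₀ q _ hAM (hgeo t ht) (hulim t ht)
    rw [zero_add, dist_comm, dist_eq_norm] at h1
    have h2 := norm_sub_le_norm_sub_add_norm_sub (u t) ((U 1).1 t) (ubar t)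
    have h3 : ‖A‖ * N * M t / (1 - q) = ‖A‖ * N / (1 - q) * M t := by ring
    linarith [hfirst t ht]
  have hu : MemLp u p (lebesgue t₀ T) := by
    have hsub : MemLp (u - ubar) p (lebesgue t₀ T) := by
      refine MemLp.mono' (hρ.add (hM.const_mul (‖A‖ * N / (1 - q)))) ?_ ?_
      · refine AEStronglyMeasurable.sub ?_ hubar.1
        refine aestronglyMeasurable_of_tendsto_ae atTop (fun k => (U (k + 1)).2.1) ?_
        filter_upwards [hS] with t ht using hulim t ht
      · filter_upwards [hS] with t ht using hubound t ht
    simpa using hsub.add hubar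
  -- The pointwise tail bound is a multiple of `M t`, so it integrates to L_p convergence.
  have hVu : ∀ k, ‖V (k + 1) - hu.toLp u‖ ≤ ‖A‖ * N * q ^ k / (1 - q) * ‖hM.toLp M‖ := by
    intro k
    refine norm_toLp_sub_le_of_le_mul (by positivity) (U (k + 1)).2 hu hM ?_
    filter_upwards [hS] with t ht
    have h1 := dist_le_of_le_geometric_of_tendsto q _ hAM (hgeo t ht) (hulim t ht) k
    rw [dist_eq_norm] at h1
    exact h1.trans_eq (by ring)
  have hVlim : Tendsto V atTop (𝓝 (hu.toLp u)) := by
    rw [← tendsto_add_atTop_iff_nat 1, tendsto_iff_norm_sub_tendsto_zero]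
    refine squeeze_zero (fun _ => norm_nonneg _) hVu ?_
    have := (((tendsto_pow_atTop_nhds_zero_of_lt_one hq0 hAM).const_mul (‖A‖ * N)).div_const
      (1 - q)).mul_const ‖hM.toLp M‖
    simpa using this
  refine ⟨u, hu, fun t ht => ?_, fun t ht => ?_, fun t => ?_⟩
  · have hz : Metric.infDist (u t) (F t (A (hu.toLp u) t) : Set (EucSpace n)) ≤ 0 := by
      have hA : Tendsto (fun k => A (V k) t) atTop (𝓝 (A (hu.toLp u) t)) :=
        ((continuous_eval_const t).comp A.continuous).tendsto _ |>.comp hVlim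
      refine le_of_tendsto_of_tendsto
        (f := fun k => Metric.infDist ((U (k + 1)).1 t) (F t (A (hu.toLp u) t) : Set (EucSpace n)))
        (g := fun k => M t * ‖A (V k) t - A (hu.toLp u) t‖) (b := atTop)
        (((Metric.continuous_infDist_pt _).tendsto _).comp (hulim t ht)) ?_ ?_
      · simpa using (tendsto_iff_norm_sub_tendsto_zero.1 hA).const_mul (M t)
      · refine Eventually.of_forall fun k => ?_
        have := hinf t ht (A (V k) t) (A (hu.toLp u) t) ((U (k + 1)).1 t)
        rwa [Metric.infDist_zero_of_mem (hmem k t ht), zero_add] at this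
    exact ((F t (A (hu.toLp u) t)).isCompact.isClosed.mem_iff_infDist_zero
      (F t (A (hu.toLp u) t)).nonempty).2 (le_antisymm hz Metric.infDist_nonneg)
  · exact (hubound t ht).trans_eq (by ring)
  · refine (A.norm_apply_sub_apply_le _ _ t).trans ?_
    have h1 : ‖hu.toLp u - hubar.toLp ubar‖ ≤ N + ‖A‖ * N / (1 - q) * ‖hM.toLp M‖ := by
      refine norm_toLp_sub_le_of_le_add_mul (by positivity) hu hubar hρ hM ?_
      filter_upwards [hS] with t ht using hubound t ht
    refine (mul_le_mul_of_nonneg_left h1 (norm_nonneg A)).trans_eq ?_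
    -- What remains is N + N q / (1 - q) = N / (1 - q).
    have h2 : ‖A‖ * N / (1 - q) * ‖hM.toLp M‖ = N * q / (1 - q) := by rw [hq]; ring
    rw [h2]
    field_simp
    ring
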